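/- A weighted oriented graph $D=(V(D),E(D),w)$ consists of a finite set $V(D)$, a set of edges $E(D)\subseteq V(D)\times V(D)$ without loops and without pairs of opposite edges (if $(x,y)\in E(D)$ then $x\neq y$ and $(y,x)\notin E(D)$), and a weight function $w$ from $V(D)$ to the positive integers. Its underlying graph $G$ is the simple graph on $V(D)$ with edges $\{x,y\}$ for $(x,y)\in E(D)$. Let $K$ be a field, let $V(D)=\{x_1,\dots,x_n\}$ with $n\ge 1$, let $R=K[x_1,\dots,x_n]$, and let $$I(D)=\bigl(x_i x_j^{w(x_j)} : (x_i,x_j)\in E(D)\bigr)\subseteq R$$ be the edge ideal of $D$. An ideal is unmixed if all its associated primes have the same height. An oriented subgraph of $D$ is given by a subset of $V(D)$ and a set of edges of $D$ between vertices of this subset (not necessarily all of them), with the weights of $D$. A weighted oriented graph $D'$ with underlying graph $G'$ is called a unicycle oriented graph if 1. $G'$ is connected and has exactly one cycle $C$; 2. $C$ is an oriented cycle in $D'$, and for each vertex $y$ of $D'$ outside $C$ there is an oriented path in $D'$ from a vertex of $C$ to $y$; 3. $w(x)\neq 1$ for every vertex $x$ with $\deg_{G'}(x)\geq 2$. **Theorem.**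 If the underlying graph $G$ of $D$ is a complete graph, then the following conditions are equivalent: 1. $I(D)$ is unmixed; 2. the ring $R/I(D)$ is Cohen–Macaulay; 3. there are no unicycle oriented subgraphs $D_1,\dots,D_s$ of $D$ such that $V(D_1),\dots,V(D_s)$ is a partition of $V(D)$. -/

import Mathlib

open MvPolynomial

/-- A weighted oriented graph on the vertex set `V`: `Arc x y` says that `(x, y)` is an edge with
tail `x` and head `y`. There are no loops and at most one of `(x, y)`, `(y, x)` is an edge (both are
contained in `asymm`), and the weights are positive integers. -/
structure WeightedOrientedGraph (V : Type*) where
  Arc : V → V → Prop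
  weight : V → ℕ
  asymm : ∀ x y, Arc x y → ¬ Arc y x
  weight_pos : ∀ x, 0 < weight x

namespace WeightedOrientedGraph

variable {V : Type*}

/-- The underlying simple graph. -/
def underlyingGraph (D : WeightedOrientedGraph V) : SimpleGraph V where
  Adj x y := D.Arc x y ∨ D.Arc y x
  symm := ⟨fun _ _ h => h.symm⟩
  loopless := ⟨fun x h => h.elim (fun h => D.asymm x x h h) (fun h => D.asymm x x h h)⟩

/-- A walk of the underlying graph all of whose steps follow the orientation of the edges. -/
def IsOrientedWalk (D : WeightedOrientedGraph V) {x y : V} (p : D.underlyingGraph.Walk x y) :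
    Prop :=
  ∀ d ∈ p.darts, D.Arc d.fst d.snd

/-- `D` is a unicycle oriented graph: its underlying graph is connected and has exactly one cycle
(cycles being compared as subgraphs); this cycle is an oriented cycle of `D`; every vertex outside
the cycle is reached from the cycle by an oriented path; and every vertex of degree at least two
has weight different from one. -/
def IsUnicycle (D : WeightedOrientedGraph V) : Prop :=
  D.underlyingGraph.Connected ∧
  (∃ (u : V) (c : D.underlyingGraph.Walk u u),
    c.IsCycle ∧
    (∀ (v : V) (c' : D.underlyingGraph.Walk v v), c'.IsCycle → c'.toSubgraph = c.toSubgraph) ∧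
    D.IsOrientedWalk c ∧
    (∀ y, y ∉ c.support → ∃ x ∈ c.support, ∃ p : D.underlyingGraph.Walk x y,
      p.IsPath ∧ D.IsOrientedWalk p)) ∧
  (∀ x, 2 ≤ (D.underlyingGraph.neighborSet x).encard → D.weight x ≠ 1)

/-- An oriented subgraph of `D` (not necessarily induced). -/
structure Subgraph (D : WeightedOrientedGraph V) where
  verts : Set V
  Arc : V → V → Prop
  arc_of_arc : ∀ x y, Arc x y → D.Arc x y
  tail_mem : ∀ x y, Arc x y → x ∈ verts
  head_mem : ∀ x y, Arc x y → y ∈ verts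

/-- An oriented subgraph of `D`, with the weights of `D`, as a weighted oriented graph on its own
vertex set. -/
def Subgraph.coe {D : WeightedOrientedGraph V} (H : D.Subgraph) :
    WeightedOrientedGraph H.verts where
  Arc x y := H.Arc x y
  weight x := D.weight x
  asymm x y h h' := D.asymm x y (H.arc_of_arc x y h) (H.arc_of_arc y x h')
  weight_pos x := D.weight_pos x

/-- The vertex set of `D` is partitioned by the vertex sets of finitely many unicycle oriented
subgraphs of `D`. -/
def HasUnicyclePartition (D : WeightedOrientedGraph V) : Prop :=
  ∃ (s : ℕ) (H : Fin s → D.Subgraph),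
    (∀ i, (H i).coe.IsUnicycle) ∧
    (∀ i j, i ≠ j → Disjoint (H i).verts (H j).verts) ∧
    (⋃ i, (H i).verts) = Set.univ

/-- The edge ideal `I(D)`, generated by the monomials `x * y ^ w(y)` for the edges `(x, y)`. -/
noncomputable def edgeIdeal (K : Type*) [Field K] (D : WeightedOrientedGraph V) : Ideal (MvPolynomial V K) :=
  Ideal.span {f | ∃ x y, D.Arc x y ∧ f = X x * X y ^ D.weight y}

end WeightedOrientedGraph

/-- An ideal is unmixed if all its associated primes, that is, the associated primes of the module
`R ⧸ I`, have the same height. -/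
def Ideal.IsUnmixed {R : Type*} [CommRing R] (I : Ideal R) : Prop :=
  ∀ P ∈ associatedPrimes R (R ⧸ I), ∀ Q ∈ associatedPrimes R (R ⧸ I), P.height = Q.height

/-- The depth of a local ring: the supremum of the lengths of the regular sequences in its maximal
ideal. -/
noncomputable def localRingDepth (A : Type*) [CommRing A] [IsLocalRing A] : ℕ∞ :=
  sSup {n : ℕ∞ | ∃ rs : List A, (∀ r ∈ rs, r ∈ IsLocalRing.maximalIdeal A) ∧
    RingTheory.Sequence.IsRegular A rs ∧ n = (rs.length : ℕ∞)}

/-- A ring is Cohen–Macaulay if it is Noetherian and, for each maximal ideal, the depth of the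
localization equals its Krull dimension. -/
def IsCohenMacaulayRing (A : Type*) [CommRing A] : Prop :=
  IsNoetherianRing A ∧
  ∀ (P : Ideal A) [P.IsMaximal],
    (localRingDepth (Localization.AtPrime P) : WithBot ℕ∞) = ringKrullDim (Localization.AtPrime P)

/-! Everything reduces to one local condition, `HasHeavyInNeighbors`. For any finite `D` it is
equivalent to having a unicycle partition: choosing a heavy in-neighbour `p y` for every `y` gives a
functional graph, whose components each have a single cycle.

For complete `G`, the minimal primes of `I(D)` are the axis ideals `P_i = (x_j : j ≠ i)`, all of the
same height, and `I(D)` lies in a `P_i`-primary monomial ideal `q_i` (`axisComponent`). Without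
heavy in-neighbours everywhere, `I(D)` is the intersection of the `q_i`
(`mem_edgeIdeal_of_forall_mem_axisComponent`). Hence only the `P_i` are associated, and any element
outside all of them is a nonzerodivisor on a quotient of dimension at most one, which is therefore
Cohen–Macaulay. If every vertex has a heavy in-neighbour, the colon of `I(D)` by the monomial with
exponents `w(x_j) - 1` is the ideal of the origin (`exists_colon_eq_originIdeal`). This embedded
prime destroys unmixedness, and it makes the depth at the origin zero while the dimension there is
positive. -/

namespace WeightedOrientedGraph

/-- Every vertex has an in-neighbour whose weight is not one. -/
def HasHeavyInNeighbors {V : Type*} (D : WeightedOrientedGraph V) : Prop :=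
  ∀ y, ∃ x, D.Arc x y ∧ D.weight x ≠ 1

/-! ### Unicycle partitions force heavy in-neighbours -/

section Unicycle

variable {W : Type*} {D : WeightedOrientedGraph W}

lemma IsOrientedWalk.exists_arc_of_not_nil {x y : W} {p : D.underlyingGraph.Walk x y}
    (hp : D.IsOrientedWalk p) (h : ¬ p.Nil) : ∃ z, D.Arc z y :=
  ⟨_, hp (p.lastDart h) (p.lastDart_mem_darts h)⟩

lemma IsUnicycle.exists_arc (hD : D.IsUnicycle) (y : W) : ∃ x, D.Arc x y := by
  classical
  obtain ⟨-, ⟨u, c, hc, -, hco, hp⟩, -⟩ := hD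
  by_cases hy : y ∈ c.support
  · refine IsOrientedWalk.exists_arc_of_not_nil (p := c.rotate y hy) (fun d hd => hco d ?_)
      (hc.rotate hy).not_nil
    exact (c.rotate_darts y hy).mem_iff.mp hd
  · obtain ⟨x, hx, p, -, hpo⟩ := hp y hy
    refine hpo.exists_arc_of_not_nil fun hn => hy ?_
    exact hn.eq ▸ hx

/-- An in-neighbour `x` of `y` has an in-neighbour `z` itself, and `z ≠ y` by asymmetry; so `x` has
degree at least two and the weight condition applies to it. -/
lemma IsUnicycle.hasHeavyInNeighbors (hD : D.IsUnicycle) : D.HasHeavyInNeighbors := by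
  intro y
  obtain ⟨x, hx⟩ := hD.exists_arc y
  obtain ⟨z, hz⟩ := hD.exists_arc x
  refine ⟨x, hx, hD.2.2 x ?_⟩
  have hne : z ≠ y := by
    rintro rfl
    exact D.asymm _ _ hx hz
  rw [← Set.encard_pair hne]
  refine Set.encard_le_encard ?_
  rintro a (rfl | rfl)
  · exact Or.inr hz
  · exact Or.inl hx

lemma HasUnicyclePartition.hasHeavyInNeighbors (hD : D.HasUnicyclePartition) :
    D.HasHeavyInNeighbors := by
  obtain ⟨s, H, hH, -, hU⟩ := hD
  intro y
  obtain ⟨i, hi⟩ := Set.mem_iUnion.mp (hU ▸ Set.mem_univ y)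
  obtain ⟨x, hx, hw⟩ := (hH i).hasHeavyInNeighbors ⟨y, hi⟩
  exact ⟨x, (H i).arc_of_arc _ _ hx, hw⟩

end Unicycle

/-! ### Functional graphs: every vertex `y` has the single in-neighbour `p y` -/

section Parent

open Function

variable {W : Type*} {D : WeightedOrientedGraph W} {p : W → W}

lemma adj_parent (hp : ∀ x y, D.Arc x y ↔ p y = x) (y : W) : D.underlyingGraph.Adj (p y) y :=
  Or.inl ((hp _ _).2 rfl)

lemma adj_iff_parent (hp : ∀ x y, D.Arc x y ↔ p y = x) {x y : W} :
    D.underlyingGraph.Adj x y ↔ p y = x ∨ p x = y :=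
  or_congr (hp _ _) (hp _ _)

lemma reachable_iterate_parent (hp : ∀ x y, D.Arc x y ↔ p y = x) (n : ℕ) (y : W) :
    D.underlyingGraph.Reachable (p^[n] y) y := by
  induction n with
  | zero => exact .refl _
  | succ n ih =>
    rw [iterate_succ_apply']
    exact (adj_parent hp _).reachable.trans ih

/-- The walk that descends from an iterated parent of `y` to `y`. -/
lemma exists_walk_iterate_parent (hp : ∀ x y, D.Arc x y ↔ p y = x) (n : ℕ) (y : W) :
    ∃ q : D.underlyingGraph.Walk (p^[n] y) y, D.IsOrientedWalk q ∧
      q.support = ((List.range (n + 1)).map fun k => p^[k] y).reverse ∧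
      ∀ e ∈ q.edges, ∃ k < n, e = s(p^[k + 1] y, p^[k] y) := by
  induction n with
  | zero => exact ⟨.nil, by simp [IsOrientedWalk], by simp, by simp⟩
  | succ n ih =>
    obtain ⟨q, hq, hs, he⟩ := ih
    have h : D.underlyingGraph.Adj (p^[n + 1] y) (p^[n] y) := by
      rw [iterate_succ_apply']; exact adj_parent hp _
    refine ⟨.cons h q, ?_, ?_, ?_⟩
    · intro d hd
      rw [SimpleGraph.Walk.darts_cons, List.mem_cons] at hd
      rcases hd with rfl | hd
      · exact (hp _ _).2 (iterate_succ_apply' p n y).symm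
      · exact hq d hd
    · rw [SimpleGraph.Walk.support_cons, hs, List.range_succ (n := n + 1)]
      simp
    · intro e hmem
      rw [SimpleGraph.Walk.edges_cons, List.mem_cons] at hmem
      rcases hmem with rfl | hmem
      · exact ⟨n, n.lt_succ_self, rfl⟩
      · obtain ⟨k, hk, rfl⟩ := he e hmem
        exact ⟨k, by omega, rfl⟩

lemma exists_isCycle_parent (hp : ∀ x y, D.Arc x y ↔ p y = x) {u : W} (hu : u ∈ periodicPts p) :
    ∃ c : D.underlyingGraph.Walk u u, c.IsCycle ∧ D.IsOrientedWalk c := by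
  obtain ⟨n, hn⟩ : ∃ n, minimalPeriod p u = n + 1 :=
    Nat.exists_eq_succ_of_ne_zero (minimalPeriod_pos_of_mem_periodicPts hu).ne'
  have hper : p (p^[n] u) = u := by
    rw [← iterate_succ_apply' p]
    change p^[n + 1] u = u
    rw [← hn]
    exact iterate_minimalPeriod
  have hinj : ∀ a ≤ n, ∀ b ≤ n, p^[a] u = p^[b] u → a = b := fun a ha b hb h =>
    iterate_injOn_Iio_minimalPeriod (Set.mem_Iio.2 (by omega)) (Set.mem_Iio.2 (by omega)) h
  -- The period `n + 1` is at least three: a fixed point or a 2-cycle of `p` would give a loop or a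
  -- pair of opposite arcs.
  have hn2 : 2 ≤ n := by
    by_contra! hlt
    have h : p (p u) = u := by
      interval_cases n
      · have h1 : p u = u := hper
        rw [h1, h1]
      · exact hper
    exact D.asymm _ _ ((hp _ _).2 h) ((hp _ _).2 rfl)
  obtain ⟨q, hq, hs, he⟩ := exists_walk_iterate_parent hp n u
  have h : D.underlyingGraph.Adj u (p^[n] u) := by
    have := adj_parent hp (p^[n] u)
    rwa [hper] at this
  refine ⟨.cons h q, (SimpleGraph.Walk.cons_isCycle_iff q h).2 ⟨?_, ?_⟩, ?_⟩
  · rw [SimpleGraph.Walk.isPath_def, hs, List.nodup_reverse]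
    refine List.nodup_range.map_on fun a ha b hb hab => ?_
    rw [List.mem_range] at ha hb
    exact hinj a (by omega) b (by omega) hab
  · intro hmem
    obtain ⟨k, hk, hkk⟩ := he _ hmem
    rw [Sym2.eq_iff] at hkk
    rcases hkk with ⟨h1, -⟩ | ⟨h1, h2⟩
    · exact absurd (hinj 0 (by omega) (k + 1) (by omega) h1) (by omega)
    · have := hinj 0 (by omega) k (by omega) h1
      have := hinj n le_rfl (k + 1) (by omega) h2
      omega
  · intro d hd
    rw [SimpleGraph.Walk.darts_cons, List.mem_cons] at hd
    rcases hd with rfl | hd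
    · exact (hp _ _).2 hper
    · exact hq d hd

/-- On a cycle `y` has two neighbours, of which at most one is its parent; the other is a child. -/
lemma exists_child_of_mem_cycle (hp : ∀ x y, D.Arc x y ↔ p y = x) {v : W}
    {c : D.underlyingGraph.Walk v v} (hc : c.IsCycle) {y : W} (hy : y ∈ c.support) :
    ∃ z ∈ c.support, c.toSubgraph.Adj y z ∧ p z = y := by
  obtain ⟨a, b, hab, hs⟩ := Set.ncard_eq_two.1 (hc.ncard_neighborSet_toSubgraph_eq_two hy)
  have key : ∀ z ∈ c.toSubgraph.neighborSet y, z ≠ p y →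
      ∃ z ∈ c.support, c.toSubgraph.Adj y z ∧ p z = y := by
    intro z hz hne
    have hadj : c.toSubgraph.Adj y z := hz
    refine ⟨z, ?_, hadj, ?_⟩
    · exact (SimpleGraph.Walk.mem_verts_toSubgraph c).1 (c.toSubgraph.edge_vert hadj.symm)
    · exact ((adj_iff_parent hp).1 hadj.adj_sub).resolve_right hne.symm
  by_cases h : a = p y
  · exact key b (by rw [hs]; simp) fun hb => hab (h.trans hb.symm)
  · exact key a (by rw [hs]; simp) h

lemma bijOn_cycle_parent [Finite W] (hp : ∀ x y, D.Arc x y ↔ p y = x) {v : W}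
    {c : D.underlyingGraph.Walk v v} (hc : c.IsCycle) :
    Set.BijOn p {x | x ∈ c.support} {x | x ∈ c.support} := by
  set S : Set W := {x | x ∈ c.support}
  have hsub : S ⊆ p '' S := fun y hy => by
    obtain ⟨z, hz, -, rfl⟩ := exists_child_of_mem_cycle hp hc hy
    exact ⟨z, hz, rfl⟩
  have hcard : (p '' S).ncard ≤ S.ncard := Set.ncard_image_le S.toFinite
  have heq : S = p '' S := Set.eq_of_subset_of_ncard_le hsub hcard
  refine ⟨fun x hx => heq ▸ ⟨x, hx, rfl⟩, ?_, hsub⟩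
  exact Set.injOn_of_ncard_image_eq (by rw [← heq])

/-- Uniqueness of the cycle: its vertex set is determined by `p` alone. Since `p` permutes the
cycle, its vertices are periodic; conversely a periodic orbit meets the orbit of `v`, which stays in
the cycle. -/
lemma mem_cycle_support_iff [Finite W] (hp : ∀ x y, D.Arc x y ↔ p y = x)
    (hconn : ∀ x y, ∃ a b, p^[a] x = p^[b] y) {v : W}
    {c : D.underlyingGraph.Walk v v} (hc : c.IsCycle) (y : W) :
    y ∈ c.support ↔ y ∈ periodicPts p := by
  have hb := bijOn_cycle_parent hp hc
  constructor
  · intro hy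
    obtain ⟨m, n, hmn, h⟩ := Finite.exists_ne_map_eq_of_infinite fun n : ℕ => p^[n] y
    wlog hlt : m < n generalizing m n
    · exact this n m hmn.symm h.symm (by omega)
    have hiter : Set.InjOn p^[m] {x | x ∈ c.support} := hb.injOn.iterate hb.mapsTo m
    refine mk_mem_periodicPts (n := n - m) (by omega) ?_
    refine hiter (hb.mapsTo.iterate _ hy) hy ?_
    rw [← iterate_add_apply, h]
    congr 2
    omega
  · intro hy
    obtain ⟨a, b, hab⟩ := hconn y v
    obtain ⟨n, hn, hper⟩ := hy
    have h1 : p^[b] v ∈ c.support := hb.mapsTo.iterate b c.start_mem_support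
    -- A multiple of the period exceeding `a`, so that the orbit passes through the meeting point
    -- before returning to `y`.
    have h2 : p^[n * (a + 1)] y = y := (hper.mul_const (a + 1)).eq
    have h3 : n * (a + 1) = (n * (a + 1) - a) + a := by
      have : a + 1 ≤ n * (a + 1) := Nat.le_mul_of_pos_left _ hn
      omega
    rw [h3, iterate_add_apply, hab] at h2
    exact h2 ▸ hb.mapsTo.iterate _ h1

lemma cycle_toSubgraph_adj_iff [Finite W] (hp : ∀ x y, D.Arc x y ↔ p y = x)
    (hconn : ∀ x y, ∃ a b, p^[a] x = p^[b] y) {v : W}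
    {c : D.underlyingGraph.Walk v v} (hc : c.IsCycle) (x y : W) :
    c.toSubgraph.Adj x y ↔
      x ∈ periodicPts p ∧ y ∈ periodicPts p ∧ (p y = x ∨ p x = y) := by
  have hb := bijOn_cycle_parent hp hc
  have key : ∀ z ∈ c.support, c.toSubgraph.Adj (p z) z := by
    intro z hz
    obtain ⟨z', hz', hadj, h⟩ := exists_child_of_mem_cycle hp hc (hb.mapsTo hz)
    rwa [hb.injOn hz' hz h] at hadj
  simp only [← mem_cycle_support_iff hp hconn hc]
  constructor
  · intro h
    refine ⟨?_, ?_, (adj_iff_parent hp).1 h.adj_sub⟩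
    · exact (SimpleGraph.Walk.mem_verts_toSubgraph c).1 (c.toSubgraph.edge_vert h)
    · exact (SimpleGraph.Walk.mem_verts_toSubgraph c).1 (c.toSubgraph.edge_vert h.symm)
  · rintro ⟨hx, hy, rfl | rfl⟩
    · exact key y hy
    · exact (key x hx).symm

lemma exists_iterate_mem_periodicPts [Finite W] (p : W → W) (x : W) :
    ∃ n, p^[n] x ∈ periodicPts p := by
  obtain ⟨m, n, hmn, h⟩ := Finite.exists_ne_map_eq_of_infinite fun n : ℕ => p^[n] x
  wlog hlt : m < n generalizing m n
  · exact this n m hmn.symm h.symm (by omega)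
  refine ⟨m, mk_mem_periodicPts (n := n - m) (by omega) ?_⟩
  change p^[n - m] (p^[m] x) = p^[m] x
  rw [← iterate_add_apply, h]
  congr 2
  omega

/-- The graph of a function all of whose orbits meet is a unicycle oriented graph, as soon as the
vertices with at least one child have weight different from one. -/
lemma isUnicycle_of_parent [Finite W] [Nonempty W] (hp : ∀ x y, D.Arc x y ↔ p y = x)
    (hconn : ∀ x y, ∃ a b, p^[a] x = p^[b] y) (hw : ∀ x, D.weight (p x) ≠ 1) :
    D.IsUnicycle := by
  classical
  refine ⟨⟨fun x y => ?_⟩, ?_, fun x hx => ?_⟩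
  · obtain ⟨a, b, hab⟩ := hconn x y
    have h := reachable_iterate_parent hp a x
    rw [hab] at h
    exact h.symm.trans (reachable_iterate_parent hp b y)
  · obtain ⟨n, hu⟩ := exists_iterate_mem_periodicPts p (Classical.arbitrary W)
    obtain ⟨c, hc, hco⟩ := exists_isCycle_parent hp hu
    refine ⟨_, c, hc, fun v c' hc' => ?_, hco, fun y _ => ?_⟩
    · refine SimpleGraph.Subgraph.ext ?_ ?_
      · ext x
        rw [SimpleGraph.Walk.mem_verts_toSubgraph, SimpleGraph.Walk.mem_verts_toSubgraph,
          mem_cycle_support_iff hp hconn hc', mem_cycle_support_iff hp hconn hc]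
      · ext x y
        rw [cycle_toSubgraph_adj_iff hp hconn hc', cycle_toSubgraph_adj_iff hp hconn hc]
    · obtain ⟨m, hm⟩ := exists_iterate_mem_periodicPts p y
      obtain ⟨q, hq, -⟩ := exists_walk_iterate_parent hp m y
      exact ⟨_, (mem_cycle_support_iff hp hconn hc _).2 hm, q.bypass, q.bypass_isPath,
        fun d hd => hq d (q.darts_bypass_subset_darts hd)⟩
  -- A childless vertex is adjacent only to its parent, so degree two forces a child.
  · have : ∃ z, p z = x := by
      by_contra! h
      have hsub : D.underlyingGraph.neighborSet x ⊆ {p x} := fun z hz =>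
        (((adj_iff_parent hp).1 hz).resolve_left (h z)).symm
      have := hx.trans (Set.encard_le_encard hsub)
      rw [Set.encard_singleton] at this
      exact absurd this (by decide)
    obtain ⟨z, rfl⟩ := this
    exact hw z

end Parent

/-! ### Partition into orbit classes of a parent function -/

section Partition

open Function

variable {V : Type*} {D : WeightedOrientedGraph V}

/-- Two points are related if their orbits under `p` meet. -/
def orbitSetoid (p : V → V) : Setoid V where
  r x y := ∃ a b, p^[a] x = p^[b] y
  iseqv :=
    { refl := fun x => ⟨0, 0, rfl⟩
      symm := fun ⟨a, b, h⟩ => ⟨b, a, h.symm⟩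
      trans := by
        rintro x y z ⟨a, b, h⟩ ⟨c, d, h'⟩
        refine ⟨c + a, b + d, ?_⟩
        rw [iterate_add_apply, h, ← iterate_add_apply, add_comm, iterate_add_apply, h',
          ← iterate_add_apply] }

lemma HasHeavyInNeighbors.hasUnicyclePartition [Finite V] (hD : D.HasHeavyInNeighbors) :
    D.HasUnicyclePartition := by
  choose p hp hw using hD
  let S := orbitSetoid p
  have hS : ∀ x, (Quotient.mk S (p x)) = Quotient.mk S x := fun x =>
    Quotient.sound ⟨0, 1, rfl⟩
  let H : Quotient S → D.Subgraph := fun c =>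
    { verts := {x | Quotient.mk S x = c}
      Arc := fun x y => p y = x ∧ Quotient.mk S y = c
      arc_of_arc := by rintro _ y ⟨rfl, -⟩; exact hp y
      tail_mem := by rintro _ y ⟨rfl, h⟩; exact (hS y).trans h
      head_mem := fun _ _ h => h.2 }
  obtain ⟨s, ⟨e⟩⟩ := Finite.exists_equiv_fin (Quotient S)
  refine ⟨s, fun i => H (e.symm i), fun i => ?_, fun i j hij => ?_, ?_⟩
  · change (H (e.symm i)).coe.IsUnicycle
    generalize e.symm i = c
    let p' : (H c).verts → (H c).verts := fun y => ⟨p y, (hS y).trans y.2⟩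
    have hiter : ∀ n y, ((p'^[n] y : (H c).verts) : V) = p^[n] y := by
      intro n y
      induction n with
      | zero => rfl
      | succ n ih => rw [iterate_succ_apply', iterate_succ_apply', ← ih]
    have : Nonempty (H c).verts := by
      obtain ⟨x, hx⟩ := Quotient.exists_rep c
      exact ⟨⟨x, hx⟩⟩
    refine isUnicycle_of_parent (p := p') ?_ ?_ ?_
    · intro x y
      exact ⟨fun h => Subtype.ext h.1, fun h => ⟨congrArg Subtype.val h, y.2⟩⟩
    · intro x y
      obtain ⟨a, b, h⟩ := Quotient.exact (x.2.trans y.2.symm)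
      exact ⟨a, b, Subtype.ext (by rw [hiter, hiter]; exact h)⟩
    · exact fun x => hw x
  · refine Set.disjoint_left.2 fun x hx hx' => hij ?_
    exact e.symm.injective (hx.symm.trans hx')
  · exact Set.eq_univ_of_forall fun x =>
      Set.mem_iUnion.2 ⟨e (Quotient.mk S x), (e.symm_apply_apply _).symm⟩

lemma hasUnicyclePartition_iff [Finite V] :
    D.HasUnicyclePartition ↔ D.HasHeavyInNeighbors :=
  ⟨fun h => h.hasHeavyInNeighbors, fun h => h.hasUnicyclePartition⟩

end Partition

end WeightedOrientedGraph

/-! ### Monomial ideals and the primes of the coordinate axes -/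

namespace MvPolynomial

variable {V : Type*} {K : Type*} [Field K]

/-- A nonzero polynomial in the variable `X i` alone is a nonzerodivisor modulo an ideal generated
by monomials in the other variables. -/
lemma mem_span_monomial_of_aeval_X_mul_mem {S : Set (V →₀ ℕ)} {i : V} (hS : ∀ s ∈ S, s i = 0)
    {p : Polynomial K} (hp : p ≠ 0) {f : MvPolynomial V K}
    (h : Polynomial.aeval (X i : MvPolynomial V K) p * f ∈
      Ideal.span ((fun s => monomial s (1 : K)) '' S)) :
    f ∈ Ideal.span ((fun s => monomial s (1 : K)) '' S) := by
  classical
  set q := Ideal.span ((fun s => monomial s (1 : K)) '' S) with hq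
  -- The span of the monomials outside `q` is a linear complement of `q`, stable under
  -- multiplication by `X i`.
  set N := restrictSupport K {m : V →₀ ℕ | ∀ s ∈ S, ¬ s ≤ m} with hN
  have hdisj : ∀ g ∈ N, g ∈ q → g = 0 := by
    intro g hg hgq
    rw [hq, mem_ideal_span_monomial_image] at hgq
    rw [hN, mem_restrictSupport_iff] at hg
    rw [← support_eq_empty, Finset.eq_empty_iff_forall_notMem]
    intro m hm
    obtain ⟨s, hs, hsm⟩ := hgq m hm
    exact hg hm s hs hsm
  have hdecomp : ∀ g : MvPolynomial V K, ∃ g₁ ∈ q, ∃ g₂ ∈ N, g = g₁ + g₂ := by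
    intro g
    induction g using MvPolynomial.induction_on' with
    | monomial m a =>
      by_cases hm : ∃ s ∈ S, s ≤ m
      · refine ⟨monomial m a, ?_, 0, N.zero_mem, (add_zero _).symm⟩
        rw [hq, mem_ideal_span_monomial_image]
        intro m' hm'
        rw [Finset.mem_singleton.1 (support_monomial_subset hm')]
        exact hm
      · push Not at hm
        refine ⟨0, q.zero_mem, monomial m a, ?_, (zero_add _).symm⟩
        rw [hN, mem_restrictSupport_iff]
        intro m' hm'
        rw [Finset.mem_singleton.1 (support_monomial_subset hm')]
        exact hm
    | add g g' ih ih' =>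
      obtain ⟨a, ha, b, hb, rfl⟩ := ih
      obtain ⟨a', ha', b', hb', rfl⟩ := ih'
      exact ⟨_, q.add_mem ha ha', _, N.add_mem hb hb', by ring⟩
  have hX : ∀ g ∈ N, X i * g ∈ N := by
    intro g hg
    rw [hN, mem_restrictSupport_iff] at hg ⊢
    intro m hm s hs hsm
    rw [support_X_mul, Finset.mem_coe, Finset.mem_map] at hm
    obtain ⟨m', hm', rfl⟩ := hm
    refine hg hm' s hs fun j => ?_
    have hj := hsm j
    by_cases hij : i = j
    · subst hij
      rw [hS s hs]
      exact Nat.zero_le _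
    · simpa [Finsupp.single_apply, hij] using hj
  have hXn : ∀ n, ∀ g ∈ N, X i ^ n * g ∈ N := by
    intro n
    induction n with
    | zero => intro g hg; simpa using hg
    | succ n ih => intro g hg; rw [pow_succ, mul_assoc]; exact ih _ (hX g hg)
  have hpoly : ∀ (r : Polynomial K), ∀ g ∈ N,
      Polynomial.aeval (X i : MvPolynomial V K) r * g ∈ N := by
    intro r g hg
    induction r using Polynomial.induction_on' with
    | add r r' h h' => rw [map_add, add_mul]; exact N.add_mem h h'
    | monomial n a =>
      rw [Polynomial.aeval_monomial, mul_assoc, algebraMap_eq, ← smul_eq_C_mul]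
      exact N.smul_mem a (hXn n g hg)
  have hne : Polynomial.aeval (X i : MvPolynomial V K) p ≠ 0 := by
    intro h0
    refine hp ?_
    have := congrArg (aeval fun _ : V => (Polynomial.X : Polynomial K)) h0
    rwa [← Polynomial.aeval_algHom_apply, aeval_X, Polynomial.aeval_X_left_apply, map_zero] at this
  obtain ⟨f₁, hf₁, f₂, hf₂, rfl⟩ := hdecomp f
  have h2 : Polynomial.aeval (X i : MvPolynomial V K) p * f₂ ∈ q := by
    rw [mul_add] at h
    exact (q.add_mem_iff_right (q.mul_mem_left _ hf₁)).1 h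
  have h3 := hdisj _ (hpoly p _ hf₂) h2
  rw [(mul_eq_zero.1 h3).resolve_left hne, add_zero]
  exact hf₁

section AxisIdeal

variable (K)

open Classical in
/-- Restriction of polynomials to the `i`-th coordinate axis. -/
noncomputable def toAxis (i : V) : MvPolynomial V K →ₐ[K] Polynomial K :=
  aeval fun j => if j = i then Polynomial.X else 0

lemma toAxis_X_self (i : V) : toAxis K i (X i) = Polynomial.X := by simp [toAxis]

lemma toAxis_X_of_ne {i j : V} (h : j ≠ i) : toAxis K i (X j) = 0 := by simp [toAxis, h]

lemma toAxis_aeval_X (i : V) (p : Polynomial K) :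
    toAxis K i (Polynomial.aeval (X i : MvPolynomial V K) p) = p := by
  rw [← Polynomial.aeval_algHom_apply, toAxis_X_self, Polynomial.aeval_X_left_apply]

lemma toAxis_surjective (i : V) : Function.Surjective (toAxis K i) := fun p =>
  ⟨_, toAxis_aeval_X K i p⟩

/-- The ideal generated by all the variables but the `i`-th one, as the kernel of the restriction
to the `i`-th coordinate axis. -/
noncomputable def axisIdeal (i : V) : Ideal (MvPolynomial V K) := RingHom.ker (toAxis K i)

instance (i : V) : (axisIdeal K i).IsPrime := RingHom.ker_isPrime _

variable {K}

lemma mem_axisIdeal {i : V} {f : MvPolynomial V K} : f ∈ axisIdeal K i ↔ toAxis K i f = 0 :=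
  RingHom.mem_ker

lemma X_mem_axisIdeal_iff {i j : V} : (X j : MvPolynomial V K) ∈ axisIdeal K i ↔ j ≠ i := by
  rw [mem_axisIdeal]
  constructor
  · rintro h rfl
    rw [toAxis_X_self] at h
    exact Polynomial.X_ne_zero h
  · exact toAxis_X_of_ne K

/-- Modulo `J` every polynomial agrees with its restriction to the axis. -/
lemma axisIdeal_le {i : V} {J : Ideal (MvPolynomial V K)} (hJ : ∀ j ≠ i, X j ∈ J) :
    axisIdeal K i ≤ J := by
  intro f hf
  have h : (Ideal.Quotient.mkₐ K J).comp ((Polynomial.aeval (X i)).comp (toAxis K i)) =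
      Ideal.Quotient.mkₐ K J := by
    refine algHom_ext fun j => ?_
    by_cases hj : j = i
    · subst hj
      simp [toAxis_X_self]
    · simp only [AlgHom.comp_apply, toAxis_X_of_ne K hj, map_zero]
      exact (Ideal.Quotient.eq_zero_iff_mem.2 (hJ j hj)).symm
  have := DFunLike.congr_fun h f
  simp only [AlgHom.comp_apply, mem_axisIdeal.1 hf, map_zero] at this
  exact Ideal.Quotient.eq_zero_iff_mem.1 this.symm

lemma axisIdeal_le_axisIdeal_iff {i j : V} : axisIdeal K i ≤ axisIdeal K j ↔ i = j := by
  refine ⟨fun h => ?_, fun h => h ▸ le_rfl⟩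
  by_contra hij
  exact X_mem_axisIdeal_iff.1 (h (X_mem_axisIdeal_iff.2 (Ne.symm hij))) rfl

lemma isMaximal_of_axisIdeal_lt {i : V} {Q : Ideal (MvPolynomial V K)} [Q.IsPrime]
    (h : axisIdeal K i < Q) : Q.IsMaximal := by
  have hs := toAxis_surjective K i
  have hker : RingHom.ker (toAxis K i) ≤ Q := h.le
  have hcomap : (Q.map (toAxis K i)).comap (toAxis K i) = Q := by
    rw [Ideal.comap_map_of_surjective' _ hs]
    exact sup_eq_left.2 hker
  have : (Q.map (toAxis K i)).IsPrime := Ideal.map_isPrime_of_surjective hs hker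
  have hne : Q.map (toAxis K i) ≠ ⊥ := by
    intro h0
    rw [h0] at hcomap
    exact h.ne hcomap
  have := Ideal.IsPrime.isMaximal this hne
  rw [← hcomap]
  exact Ideal.comap_isMaximal_of_surjective _ hs

variable (V K) in
/-- The ideal of the polynomials that vanish at the origin. -/
noncomputable def originIdeal : Ideal (MvPolynomial V K) := RingHom.ker (constantCoeff (σ := V))

instance : (originIdeal V K).IsMaximal :=
  RingHom.ker_isMaximal_of_surjective _ fun a => ⟨C a, constantCoeff_C V a⟩

lemma X_mem_originIdeal (i : V) : (X i : MvPolynomial V K) ∈ originIdeal V K :=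
  RingHom.mem_ker.2 (constantCoeff_X K i)

lemma originIdeal_le {J : Ideal (MvPolynomial V K)} (hJ : ∀ i, X i ∈ J) : originIdeal V K ≤ J := by
  intro f hf
  have h : f ∈ Ideal.span (X '' (Set.univ : Set V)) := by
    rw [mem_ideal_span_X_image]
    intro m hm
    by_contra! h0
    have hm0 : m = 0 := Finsupp.ext fun j => h0 j (Set.mem_univ j)
    rw [hm0, mem_support_iff, ← constantCoeff_eq] at hm
    exact hm (RingHom.mem_ker.1 hf)
  refine Ideal.span_le.2 ?_ h
  rintro _ ⟨i, -, rfl⟩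
  exact hJ i

lemma axisIdeal_lt_originIdeal (i : V) : axisIdeal K i < originIdeal V K :=
  lt_of_le_of_ne (axisIdeal_le fun j _ => X_mem_originIdeal j) fun h =>
    X_mem_axisIdeal_iff.1 (h ▸ X_mem_originIdeal i) rfl

lemma not_isMaximal_axisIdeal (i : V) : ¬ (axisIdeal K i).IsMaximal := fun h =>
  Ideal.IsPrime.ne_top inferInstance (h.1.2 _ (axisIdeal_lt_originIdeal i))

/-- Swapping two variables is an automorphism, so the height need not be computed. -/
lemma height_axisIdeal_eq (i j : V) : (axisIdeal K i).height = (axisIdeal K j).height := by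
  classical
  have hc : (toAxis K j).comp (rename (Equiv.swap i j)) = toAxis K i := by
    refine algHom_ext fun k => ?_
    rw [AlgHom.comp_apply, rename_X]
    by_cases hk : k = i
    · subst hk
      rw [Equiv.swap_apply_left, toAxis_X_self, toAxis_X_self]
    · rw [toAxis_X_of_ne K hk, toAxis_X_of_ne]
      intro h
      exact hk ((Equiv.swap i j).injective (h.trans (Equiv.swap_apply_left i j).symm))
  let e : MvPolynomial V K ≃+* MvPolynomial V K := (renameEquiv K (Equiv.swap i j)).toRingEquiv
  have he : ∀ f, e f = rename (Equiv.swap i j) f := fun _ => rfl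
  have h : (axisIdeal K j).comap e = axisIdeal K i := by
    ext f
    rw [Ideal.mem_comap, mem_axisIdeal, mem_axisIdeal, he, ← hc, AlgHom.comp_apply]
  rw [← h, RingEquiv.height_comap]

end AxisIdeal

end MvPolynomial

/-! ### Primary components of the edge ideal -/

namespace WeightedOrientedGraph

variable {V : Type*} {K : Type*} [Field K] {D : WeightedOrientedGraph V}

lemma arc_or_arc (hD : D.underlyingGraph = ⊤) {x y : V} (h : x ≠ y) : D.Arc x y ∨ D.Arc y x := by
  have : D.underlyingGraph.Adj x y := hD ▸ h
  exact this

lemma ne_of_arc {x y : V} (h : D.Arc x y) : x ≠ y := by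
  rintro rfl
  exact D.asymm _ _ h h

lemma mem_edgeIdeal_iff {f : MvPolynomial V K} :
    f ∈ D.edgeIdeal K ↔ ∀ m ∈ f.support, ∃ x y, D.Arc x y ∧ m x ≠ 0 ∧ D.weight y ≤ m y := by
  classical
  have h : D.edgeIdeal K = Ideal.span ((fun s => monomial s (1 : K)) ''
      {s | ∃ x y, D.Arc x y ∧ s = Finsupp.single x 1 + Finsupp.single y (D.weight y)}) := by
    rw [edgeIdeal]
    congr 1
    ext f
    constructor
    · rintro ⟨x, y, hxy, rfl⟩
      exact ⟨_, ⟨x, y, hxy, rfl⟩, by rw [X_pow_eq_monomial, X, monomial_mul, one_mul]⟩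
    · rintro ⟨_, ⟨x, y, hxy, rfl⟩, rfl⟩
      exact ⟨x, y, hxy, by rw [X_pow_eq_monomial, X, monomial_mul, one_mul]⟩
  rw [h, mem_ideal_span_monomial_image]
  refine forall₂_congr fun m _ => ?_
  constructor
  · rintro ⟨_, ⟨x, y, hxy, rfl⟩, hle⟩
    have hx := hle x
    have hy := hle y
    have hne := ne_of_arc hxy
    simp only [Finsupp.add_apply, Finsupp.single_apply, hne, hne.symm, if_true, if_false] at hx hy
    exact ⟨x, y, hxy, by omega, by omega⟩
  · rintro ⟨x, y, hxy, hx, hy⟩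
    refine ⟨_, ⟨x, y, hxy, rfl⟩, fun z => ?_⟩
    have hne := ne_of_arc hxy
    simp only [Finsupp.add_apply, Finsupp.single_apply]
    split_ifs with h1 h2 h2
    · exact absurd (h1.trans h2.symm) hne
    · subst h1; omega
    · subst h2; omega
    · omega

/-- The exponents of the generators of the primary component of the edge ideal of a complete graph
that belongs to the `i`-th coordinate axis. -/
def axisExponents (D : WeightedOrientedGraph V) (i : V) : Set (V →₀ ℕ) :=
  {s | ∃ j, (D.Arc j i ∧ s = Finsupp.single j 1) ∨ (D.Arc i j ∧ s = Finsupp.single j (D.weight j))}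

variable (K) in
/-- The primary component of the edge ideal of a complete graph at the `i`-th coordinate axis. -/
noncomputable def axisComponent (D : WeightedOrientedGraph V) (i : V) : Ideal (MvPolynomial V K) :=
  Ideal.span ((fun s => monomial s (1 : K)) '' D.axisExponents i)

lemma mem_axisComponent_iff {i : V} {f : MvPolynomial V K} :
    f ∈ D.axisComponent K i ↔ ∀ m ∈ f.support,
      (∃ j, D.Arc j i ∧ m j ≠ 0) ∨ ∃ j, D.Arc i j ∧ D.weight j ≤ m j := by
  rw [axisComponent, mem_ideal_span_monomial_image]
  refine forall₂_congr fun m _ => ?_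
  constructor
  · rintro ⟨_, ⟨j, ⟨h, rfl⟩ | ⟨h, rfl⟩⟩, hle⟩
    · exact Or.inl ⟨j, h, Nat.one_le_iff_ne_zero.1 (Finsupp.single_le_iff.1 hle)⟩
    · exact Or.inr ⟨j, h, Finsupp.single_le_iff.1 hle⟩
  · rintro (⟨j, h, hj⟩ | ⟨j, h, hj⟩)
    · exact ⟨_, ⟨j, Or.inl ⟨h, rfl⟩⟩, Finsupp.single_le_iff.2 (Nat.one_le_iff_ne_zero.2 hj)⟩
    · exact ⟨_, ⟨j, Or.inr ⟨h, rfl⟩⟩, Finsupp.single_le_iff.2 hj⟩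

lemma edgeIdeal_le_axisComponent (hD : D.underlyingGraph = ⊤) (i : V) :
    D.edgeIdeal K ≤ D.axisComponent K i := by
  intro f hf
  rw [mem_edgeIdeal_iff] at hf
  rw [mem_axisComponent_iff]
  intro m hm
  obtain ⟨x, y, hxy, hx, hy⟩ := hf m hm
  by_cases hyi : y = i
  · subst hyi
    exact Or.inl ⟨x, hxy, hx⟩
  · rcases arc_or_arc hD hyi with h | h
    · exact Or.inl ⟨y, h, by have := D.weight_pos y; omega⟩
    · exact Or.inr ⟨y, h, hy⟩

/-- A monomial `m` in every component but not in `I(D)` would give each `i` an in-neighbour `j` with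
`0 < m j < w(j)`, hence a heavy one. -/
lemma mem_edgeIdeal_of_forall_mem_axisComponent (hD : ¬ D.HasHeavyInNeighbors)
    {f : MvPolynomial V K} (hf : ∀ i, f ∈ D.axisComponent K i) : f ∈ D.edgeIdeal K := by
  simp only [mem_axisComponent_iff] at hf
  rw [mem_edgeIdeal_iff]
  intro m hm
  by_contra! hno
  have hin : ∀ i, ∃ j, D.Arc j i ∧ m j ≠ 0 ∨ m i = 0 ∧ D.Arc i j ∧ D.weight j ≤ m j := by
    intro i
    rcases hf i m hm with ⟨j, h, hj⟩ | ⟨j, h, hj⟩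
    · exact ⟨j, Or.inl ⟨h, hj⟩⟩
    · refine ⟨j, Or.inr ⟨?_, h, hj⟩⟩
      by_contra hi
      exact absurd hj (not_le.2 (hno i j h hi))
  have hin' : ∀ i, m i ≠ 0 → ∃ j, D.Arc j i ∧ m j ≠ 0 := fun i hi => by
    obtain ⟨j, h | h⟩ := hin i
    · exact ⟨j, h⟩
    · exact absurd h.1 hi
  have hlt : ∀ i, m i ≠ 0 → m i < D.weight i := fun i hi => by
    obtain ⟨j, h, hj⟩ := hin' i hi
    exact hno j i h hj
  refine hD fun i => ?_
  obtain ⟨j, ⟨h, hj⟩ | ⟨-, h, hj⟩⟩ := hin i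
  · exact ⟨j, h, by have := hlt j hj; omega⟩
  · have hw := D.weight_pos j
    exact absurd (hlt j (by omega)) (not_lt.2 hj)

lemma axisIdeal_le_radical_axisComponent (hD : D.underlyingGraph = ⊤) (i : V) :
    axisIdeal K i ≤ (D.axisComponent K i).radical := by
  refine axisIdeal_le fun j hj => ⟨D.weight j, ?_⟩
  rw [mem_axisComponent_iff]
  intro m hm
  rw [X_pow_eq_monomial] at hm
  rw [Finset.mem_singleton.1 (support_monomial_subset hm)]
  rcases arc_or_arc hD hj with h | h
  · exact Or.inl ⟨j, h, by simpa using (D.weight_pos j).ne'⟩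
  · exact Or.inr ⟨j, h, by simp⟩

/-- Primariness. Modulo the component, `g` differs by a nilpotent from its restriction `u` to the
axis, so a power of `u` is a multiple of `g`; and `u`, a nonzero polynomial in `X i`, is a
nonzerodivisor. -/
lemma mem_axisComponent_of_mul_mem (hD : D.underlyingGraph = ⊤) {i : V} {g f : MvPolynomial V K}
    (hg : g ∉ axisIdeal K i) (h : g * f ∈ D.axisComponent K i) : f ∈ D.axisComponent K i := by
  set u : MvPolynomial V K := Polynomial.aeval (X i) (toAxis K i g) with hu
  have hug : u - g ∈ axisIdeal K i := by
    rw [mem_axisIdeal, map_sub, hu, toAxis_aeval_X, sub_self]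
  obtain ⟨n, hn⟩ := axisIdeal_le_radical_axisComponent hD i hug
  obtain ⟨c, hc⟩ : g ∣ u ^ n - (u - g) ^ n := by
    simpa using sub_dvd_pow_sub_pow u (u - g) n
  refine mem_span_monomial_of_aeval_X_mul_mem (i := i) (p := toAxis K i g ^ n) ?_
    (pow_ne_zero n (mt mem_axisIdeal.2 hg)) ?_
  · rintro _ ⟨j, ⟨h, rfl⟩ | ⟨h, rfl⟩⟩
    · exact Finsupp.single_eq_of_ne (ne_of_arc h).symm
    · exact Finsupp.single_eq_of_ne (ne_of_arc h)
  · rw [map_pow, ← hu]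
    have : u ^ n * f = c * (g * f) + f * (u - g) ^ n := by
      rw [eq_add_of_sub_eq hc]; ring
    rw [this]
    exact Ideal.add_mem _ (Ideal.mul_mem_left _ _ h) (Ideal.mul_mem_left _ _ hn)

lemma edgeIdeal_le_axisIdeal (i : V) : D.edgeIdeal K ≤ axisIdeal K i := by
  refine Ideal.span_le.2 ?_
  rintro _ ⟨x, y, hxy, rfl⟩
  by_cases hx : x = i
  · refine Ideal.mul_mem_left _ _ (Ideal.pow_mem_of_mem _ ?_ _ (D.weight_pos y))
    exact X_mem_axisIdeal_iff.2 fun hy => ne_of_arc hxy (hx.trans hy.symm)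
  · exact Ideal.mul_mem_right _ _ (X_mem_axisIdeal_iff.2 hx)

lemma exists_axisIdeal_le [Nonempty V] (hD : D.underlyingGraph = ⊤) {Q : Ideal (MvPolynomial V K)}
    [hQ : Q.IsPrime] (h : D.edgeIdeal K ≤ Q) : ∃ i, axisIdeal K i ≤ Q := by
  by_cases hX : ∃ i, (X i : MvPolynomial V K) ∉ Q
  · obtain ⟨i, hi⟩ := hX
    refine ⟨i, axisIdeal_le fun j hj => ?_⟩
    rcases arc_or_arc hD hj with hji | hij
    · have : (X j * X i ^ D.weight i : MvPolynomial V K) ∈ Q :=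
        h (Ideal.subset_span ⟨j, i, hji, rfl⟩)
      exact (hQ.mem_or_mem this).resolve_right fun h' => hi (hQ.mem_of_pow_mem _ h')
    · have : (X i * X j ^ D.weight j : MvPolynomial V K) ∈ Q :=
        h (Ideal.subset_span ⟨i, j, hij, rfl⟩)
      exact hQ.mem_of_pow_mem _ ((hQ.mem_or_mem this).resolve_left hi)
  · push Not at hX
    exact ⟨Classical.arbitrary V, axisIdeal_le fun j _ => hX j⟩

/-- If every vertex has an in-neighbour of weight at least two, some polynomial outside the edge
ideal is multiplied into the edge ideal exactly by the polynomials vanishing at the origin. -/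
lemma HasHeavyInNeighbors.exists_colon_eq_originIdeal [Finite V] (hD : D.HasHeavyInNeighbors) :
    ∃ f : MvPolynomial V K, ∀ r, r ∈ originIdeal V K ↔ r * f ∈ D.edgeIdeal K := by
  classical
  cases nonempty_fintype V
  -- The largest exponents below all weights: one more factor `X k` reaches `w(k)`, and a heavy
  -- in-neighbour of `k` still divides the monomial.
  set m : V →₀ ℕ := Finsupp.equivFunOnFinite.symm fun j => D.weight j - 1 with hm
  have hmj : ∀ j, m j = D.weight j - 1 := fun _ => rfl
  have hnot : monomial m (1 : K) ∉ D.edgeIdeal K := by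
    rw [mem_edgeIdeal_iff]
    intro h
    obtain ⟨x, y, -, -, hy⟩ := h m (by simp [mem_support_iff])
    have := D.weight_pos y
    rw [hmj] at hy
    omega
  have hle : originIdeal V K ≤ (D.edgeIdeal K).colon {monomial m (1 : K)} := by
    refine originIdeal_le fun k => ?_
    rw [Submodule.mem_colon_singleton, smul_eq_mul, mem_edgeIdeal_iff]
    intro m' hm'
    rw [support_X_mul, Finset.mem_map] at hm'
    obtain ⟨m'', hm'', rfl⟩ := hm'
    rw [Finset.mem_singleton.1 (support_monomial_subset hm'')]
    obtain ⟨i, hik, hw⟩ := hD k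
    have h1 := D.weight_pos i
    have h2 := D.weight_pos k
    refine ⟨i, k, hik, ?_, ?_⟩
    · simp only [addLeftEmbedding_apply, Finsupp.add_apply, hmj]
      omega
    · simp only [addLeftEmbedding_apply, Finsupp.add_apply, hmj, Finsupp.single_eq_same]
      omega
  have hmax : (originIdeal V K).IsMaximal := inferInstance
  have heq : originIdeal V K = (D.edgeIdeal K).colon {monomial m (1 : K)} := by
    refine hmax.eq_of_le (fun htop => hnot ?_) hle
    have : (1 : MvPolynomial V K) ∈ (D.edgeIdeal K).colon {monomial m (1 : K)} :=
      htop ▸ Submodule.mem_top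
    simpa [Submodule.mem_colon_singleton] using this
  refine ⟨monomial m 1, fun r => ?_⟩
  rw [heq, Submodule.mem_colon_singleton, smul_eq_mul]

end WeightedOrientedGraph

/-! ### Depth of local rings of small dimension -/

section Depth

variable {A : Type*} [CommRing A] [IsLocalRing A]

lemma localRingDepth_eq_zero_of_socle {a : A} (ha : a ≠ 0)
    (h : ∀ r ∈ IsLocalRing.maximalIdeal A, r * a = 0) : localRingDepth A = 0 := by
  refine le_antisymm (sSup_le ?_) bot_le
  rintro _ ⟨rs, hrs, hreg, rfl⟩
  cases rs with
  | nil => simp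
  | cons r rs =>
    have hr := ((RingTheory.Sequence.isRegular_cons_iff A r rs).1 hreg).1
    refine absurd (hr ?_) ha
    change r * a = r * 0
    rw [h r (hrs r List.mem_cons_self), mul_zero]

lemma one_le_localRingDepth {r : A} (hr : r ∈ IsLocalRing.maximalIdeal A)
    (hreg : IsSMulRegular A r) : 1 ≤ localRingDepth A := by
  refine le_sSup ⟨[r], by simpa using hr, ?_, by simp⟩
  exact RingTheory.Sequence.IsRegular.of_isWeaklyRegular_of_mem_maximalIdeal A (by simpa using hr)
    ((RingTheory.Sequence.isWeaklyRegular_singleton_iff A r).2 hreg)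

lemma length_le_ringKrullDim_of_isRegular [IsNoetherianRing A] {rs : List A}
    (hreg : RingTheory.Sequence.IsRegular A rs) : (rs.length : WithBot ℕ∞) ≤ ringKrullDim A := by
  rw [← ringKrullDim_add_length_eq_ringKrullDim_of_isRegular rs hreg]
  have hne : Ideal.ofList rs ≠ ⊤ := by
    have := hreg.top_ne_smul
    rw [smul_eq_mul, Ideal.mul_top] at this
    exact this.symm
  have : Nontrivial (A ⧸ Ideal.ofList rs) := Ideal.Quotient.nontrivial_iff.2 hne
  exact le_add_of_nonneg_left ringKrullDim_nonneg_of_nontrivial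

/-- A Noetherian local ring of dimension at most one whose maximal ideal contains a nonzerodivisor
has depth equal to its dimension. -/
lemma localRingDepth_eq_ringKrullDim_of_isSMulRegular [IsNoetherianRing A]
    (hdim : ringKrullDim A ≤ 1) {r : A} (hr : r ∈ IsLocalRing.maximalIdeal A)
    (hreg : IsSMulRegular A r) : (localRingDepth A : WithBot ℕ∞) = ringKrullDim A := by
  have h1 : (1 : WithBot ℕ∞) ≤ ringKrullDim A := by
    have := length_le_ringKrullDim_of_isRegular
      (RingTheory.Sequence.IsRegular.of_isWeaklyRegular_of_mem_maximalIdeal A (rs := [r])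
        (by simpa using hr) ((RingTheory.Sequence.isWeaklyRegular_singleton_iff A r).2 hreg))
    simpa using this
  have hle : localRingDepth A ≤ 1 := by
    refine sSup_le ?_
    rintro _ ⟨rs, -, hrs, rfl⟩
    have := (length_le_ringKrullDim_of_isRegular hrs).trans hdim
    exact_mod_cast this
  rw [le_antisymm hle (one_le_localRingDepth hr hreg), le_antisymm hdim h1]
  rfl

end Depth

lemma isMaximal_of_isMaximal_comap_of_surjective {R S : Type*} [CommRing R] [CommRing S]
    {f : R →+* S} (hf : Function.Surjective f) {P : Ideal S} (h : (P.comap f).IsMaximal) :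
    P.IsMaximal := by
  rw [← Ideal.map_comap_of_surjective f hf P]
  refine (Ideal.map_eq_top_or_isMaximal_of_surjective f hf h).resolve_left fun htop => h.ne_top ?_
  rw [Ideal.map_comap_of_surjective f hf P] at htop
  rw [htop, Ideal.comap_top]

lemma mem_associatedPrimes_quotient_iff {R : Type*} [CommRing R] [IsNoetherianRing R]
    {I Q : Ideal R} :
    Q ∈ associatedPrimes R (R ⧸ I) ↔ Q.IsPrime ∧ ∃ f, ∀ r, r ∈ Q ↔ r * f ∈ I := by
  rw [AssociatedPrimes.mem_iff, isAssociatedPrime_iff]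
  refine and_congr_right fun _ => Ideal.Quotient.mk_surjective.exists.trans (exists_congr fun f => ?_)
  rw [SetLike.ext_iff]
  refine forall_congr' fun r => iff_congr Iff.rfl ?_
  rw [Submodule.mem_colon_singleton, Submodule.mem_bot, ← Ideal.Quotient.eq_zero_iff_mem]
  rfl

/-! ### Unmixedness and Cohen–Macaulayness of the edge ideal -/

namespace WeightedOrientedGraph

variable {V : Type*} {K : Type*} [Field K] {D : WeightedOrientedGraph V}

lemma axisIdeal_mem_associatedPrimes [Finite V] [Nonempty V] (hD : D.underlyingGraph = ⊤) (i : V) :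
    axisIdeal K i ∈
      associatedPrimes (MvPolynomial V K) (MvPolynomial V K ⧸ D.edgeIdeal K) := by
  refine Module.associatedPrimes.minimalPrimes_annihilator_subset_associatedPrimes _ _ ?_
  rw [Ideal.annihilator_quotient]
  refine ⟨⟨inferInstance, edgeIdeal_le_axisIdeal i⟩, ?_⟩
  rintro Q ⟨hQ, hIQ⟩ hle
  obtain ⟨j, hj⟩ := exists_axisIdeal_le hD hIQ
  rwa [← axisIdeal_le_axisIdeal_iff.1 (hj.trans hle)]

lemma isUnmixed_of_not_hasHeavyInNeighbors [Finite V] [Nonempty V] (hD : D.underlyingGraph = ⊤)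
    (h : ¬ D.HasHeavyInNeighbors) : (D.edgeIdeal K).IsUnmixed := by
  have key : ∀ Q ∈ associatedPrimes (MvPolynomial V K) (MvPolynomial V K ⧸ D.edgeIdeal K),
      ∃ i, Q = axisIdeal K i := by
    intro Q hQ
    obtain ⟨hQp, f, hf⟩ := mem_associatedPrimes_quotient_iff.1 hQ
    have hfI : f ∉ D.edgeIdeal K := fun hfI =>
      hQp.ne_top ((Ideal.eq_top_iff_one Q).2 ((hf 1).2 (by rwa [one_mul])))
    obtain ⟨i, hi⟩ : ∃ i, f ∉ D.axisComponent K i := by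
      by_contra! hall
      exact hfI (mem_edgeIdeal_of_forall_mem_axisComponent h hall)
    have hle : Q ≤ axisIdeal K i := fun g hg => by
      by_contra hgi
      exact hi (mem_axisComponent_of_mul_mem hD hgi
        (edgeIdeal_le_axisComponent hD i ((hf g).1 hg)))
    obtain ⟨j, hj⟩ := exists_axisIdeal_le (Q := Q) hD fun g hg =>
      (hf g).2 (Ideal.mul_mem_right _ _ hg)
    rw [axisIdeal_le_axisIdeal_iff.1 (hj.trans hle)] at hj
    exact ⟨i, le_antisymm hle hj⟩
  intro P hP Q hQ
  obtain ⟨i, rfl⟩ := key P hP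
  obtain ⟨j, rfl⟩ := key Q hQ
  exact height_axisIdeal_eq i j

lemma not_hasHeavyInNeighbors_of_isUnmixed [Finite V] [Nonempty V] (hD : D.underlyingGraph = ⊤)
    (h : (D.edgeIdeal K).IsUnmixed) : ¬ D.HasHeavyInNeighbors := by
  intro hheavy
  have i : V := Classical.arbitrary V
  have heq := h _ (axisIdeal_mem_associatedPrimes hD i) (originIdeal V K)
    (mem_associatedPrimes_quotient_iff.2 ⟨inferInstance, hheavy.exists_colon_eq_originIdeal⟩)
  exact (Ideal.height_strict_mono_of_isPrime (axisIdeal_lt_originIdeal (K := K) i)).ne heq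

/-- A prime over `I(D)` contains an axis ideal, whose quotient is `K[X]`; so it is that axis ideal
or maximal. -/
lemma krullDimLE_one_quotient_edgeIdeal [Nonempty V] (hD : D.underlyingGraph = ⊤) :
    Ring.KrullDimLE 1 (MvPolynomial V K ⧸ D.edgeIdeal K) := by
  rw [Ring.krullDimLE_one_iff]
  intro P hP
  set mk := Ideal.Quotient.mk (D.edgeIdeal K)
  have hle : ∀ J : Ideal (MvPolynomial V K ⧸ D.edgeIdeal K), D.edgeIdeal K ≤ J.comap mk :=
    fun J f hf => by
      rw [Ideal.mem_comap, Ideal.Quotient.eq_zero_iff_mem.2 hf]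
      exact J.zero_mem
  have hcomap : ∀ J J' : Ideal (MvPolynomial V K ⧸ D.edgeIdeal K),
      J.comap mk ≤ J'.comap mk ↔ J ≤ J' :=
    fun J J' => Ideal.comap_le_comap_iff_of_surjective mk Ideal.Quotient.mk_surjective J J'
  obtain ⟨i, hi⟩ := exists_axisIdeal_le hD (hle P)
  rcases hi.eq_or_lt with heq | hlt
  · refine Or.inl ⟨⟨hP, bot_le⟩, ?_⟩
    rintro J ⟨hJ, -⟩ hJP
    obtain ⟨j, hj⟩ := exists_axisIdeal_le hD (hle J)
    have hij : j = i := by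
      rw [← axisIdeal_le_axisIdeal_iff (K := K), heq]
      exact hj.trans ((hcomap J P).2 hJP)
    rw [← hcomap, ← heq, ← hij]
    exact hj
  · have hmax : (P.comap mk).IsMaximal := isMaximal_of_axisIdeal_lt hlt
    exact Or.inr (isMaximal_of_isMaximal_comap_of_surjective Ideal.Quotient.mk_surjective hmax)

lemma isCohenMacaulayRing_of_not_hasHeavyInNeighbors [Finite V] [Nonempty V]
    (hD : D.underlyingGraph = ⊤) (h : ¬ D.HasHeavyInNeighbors) :
    IsCohenMacaulayRing (MvPolynomial V K ⧸ D.edgeIdeal K) := by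
  classical
  cases nonempty_fintype V
  refine ⟨inferInstance, fun P hP => ?_⟩
  set mk := Ideal.Quotient.mk (D.edgeIdeal K) with hmk
  have hmax : (P.comap mk).IsMaximal :=
    Ideal.comap_isMaximal_of_surjective mk Ideal.Quotient.mk_surjective
  -- Prime avoidance: a maximal ideal lies in no axis ideal.
  obtain ⟨g, hgP, hg⟩ : ∃ g ∈ P.comap mk, ∀ i, g ∉ axisIdeal K i := by
    by_contra! hall
    have hsub : ((P.comap mk : Ideal (MvPolynomial V K)) : Set (MvPolynomial V K)) ⊆
        ⋃ i ∈ ((Finset.univ : Finset V) : Set V), (axisIdeal K i : Set (MvPolynomial V K)) := by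
      intro g hg
      obtain ⟨i, hi⟩ := hall g hg
      simpa using ⟨i, hi⟩
    have i₀ : V := Classical.arbitrary V
    obtain ⟨i, -, hi⟩ := (Ideal.subset_union_prime i₀ i₀ fun _ _ _ _ => inferInstance).1 hsub
    exact not_isMaximal_axisIdeal (K := K) i
      (hmax.eq_of_le (Ideal.IsPrime.ne_top inferInstance) hi ▸ hmax)
  have hreg : IsSMulRegular (MvPolynomial V K ⧸ D.edgeIdeal K) (mk g) := by
    rw [isSMulRegular_iff_right_eq_zero_of_smul]
    intro a ha
    obtain ⟨f, rfl⟩ := Ideal.Quotient.mk_surjective a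
    rw [smul_eq_mul, hmk, ← map_mul, Ideal.Quotient.eq_zero_iff_mem] at ha
    refine Ideal.Quotient.eq_zero_iff_mem.2 (mem_edgeIdeal_of_forall_mem_axisComponent h fun i => ?_)
    exact mem_axisComponent_of_mul_mem hD (hg i) (edgeIdeal_le_axisComponent hD i ha)
  have : IsNoetherianRing (Localization.AtPrime P) :=
    IsLocalization.isNoetherianRing P.primeCompl _ inferInstance
  have hdim : ringKrullDim (Localization.AtPrime P) ≤ 1 := by
    rw [IsLocalization.AtPrime.ringKrullDim_eq_height P (Localization.AtPrime P)]
    exact (Ideal.height_le_ringKrullDim_of_ne_top hP.ne_top).trans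
      (Ring.krullDimLE_iff.1 (krullDimLE_one_quotient_edgeIdeal hD))
  exact localRingDepth_eq_ringKrullDim_of_isSMulRegular hdim
    ((IsLocalization.AtPrime.to_map_mem_maximal_iff _ P (mk g)).2 hgP)
    (hreg.of_isLocalization (Localization.AtPrime P) P.primeCompl)

lemma not_hasHeavyInNeighbors_of_isCohenMacaulayRing [Finite V] [Nonempty V]
    (hCM : IsCohenMacaulayRing (MvPolynomial V K ⧸ D.edgeIdeal K)) :
    ¬ D.HasHeavyInNeighbors := by
  intro hheavy
  obtain ⟨f, hf⟩ := hheavy.exists_colon_eq_originIdeal (K := K)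
  set mk := Ideal.Quotient.mk (D.edgeIdeal K) with hmk
  have hmks : Function.Surjective mk := Ideal.Quotient.mk_surjective
  have i : V := Classical.arbitrary V
  have hker : ∀ Q : Ideal (MvPolynomial V K), D.edgeIdeal K ≤ Q → (Q.map mk).comap mk = Q :=
    fun Q hQ => by
      rw [Ideal.comap_map_of_surjective' mk hmks, hmk, Ideal.mk_ker]
      exact sup_eq_left.2 hQ
  have hkerp : ∀ Q : Ideal (MvPolynomial V K), D.edgeIdeal K ≤ Q → RingHom.ker mk ≤ Q :=
    fun Q hQ => by rwa [hmk, Ideal.mk_ker]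
  have hIi := edgeIdeal_le_axisIdeal (D := D) (K := K) i
  have hIo := hIi.trans (axisIdeal_lt_originIdeal i).le
  set P := (originIdeal V K).map mk
  have hPc : P.comap mk = originIdeal V K := hker _ hIo
  have hP : P.IsMaximal := by
    refine isMaximal_of_isMaximal_comap_of_surjective hmks ?_
    rw [hPc]
    infer_instance
  have hp : ((axisIdeal K i).map mk).IsPrime := Ideal.map_isPrime_of_surjective hmks (hkerp _ hIi)
  have hdim := hCM.2 P
  have hann : ∀ a, a ∈ P ↔ a * mk f = 0 := by
    intro a
    obtain ⟨r, rfl⟩ := hmks a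
    rw [← Ideal.mem_comap, hPc, hf, ← map_mul, hmk, Ideal.Quotient.eq_zero_iff_mem]
  -- The image of `f` is a socle element; it survives localization because its annihilator is
  -- exactly `P`.
  have hdepth : localRingDepth (Localization.AtPrime P) = 0 := by
    refine localRingDepth_eq_zero_of_socle (a := algebraMap _ _ (mk f)) ?_ ?_
    · rw [Ne, IsLocalization.map_eq_zero_iff P.primeCompl]
      rintro ⟨s, hs⟩
      exact s.2 ((hann s).2 hs)
    · intro r hr
      obtain ⟨a, s, rfl⟩ := IsLocalization.exists_mk'_eq P.primeCompl r
      rw [IsLocalization.AtPrime.mk'_mem_maximal_iff _ P] at hr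
      rw [mul_comm, IsLocalization.mul_mk'_eq_mk'_of_mul, mul_comm, (hann a).1 hr,
        IsLocalization.mk'_zero]
  rw [hdepth, IsLocalization.AtPrime.ringKrullDim_eq_height P (Localization.AtPrime P)] at hdim
  have hzero : P.height = 0 := by exact_mod_cast hdim.symm
  have hmin := Ideal.height_eq_zero_iff.1 hzero
  -- Height zero would make `P` a minimal prime, but the image of an axis ideal is a strictly
  -- smaller prime.
  have hle := hmin.2 ⟨hp, bot_le⟩ (Ideal.map_mono (axisIdeal_lt_originIdeal i).le)
  have := Ideal.comap_mono (f := mk) hle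
  rw [hPc, hker _ hIi] at this
  exact (axisIdeal_lt_originIdeal i).not_ge this

end WeightedOrientedGraph

theorem mainTheorem8 {V : Type*} [Finite V] [Nonempty V] (K : Type*) [Field K]
    (D : WeightedOrientedGraph V) (hD : D.underlyingGraph = ⊤) :
    List.TFAE
      [(D.edgeIdeal K).IsUnmixed,
        IsCohenMacaulayRing (MvPolynomial V K ⧸ D.edgeIdeal K),
        ¬ D.HasUnicyclePartition] := by
  rw [WeightedOrientedGraph.hasUnicyclePartition_iff]
  tfae_have 1 → 3 := WeightedOrientedGraph.not_hasHeavyInNeighbors_of_isUnmixed hD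
  tfae_have 3 → 1 := WeightedOrientedGraph.isUnmixed_of_not_hasHeavyInNeighbors hD
  tfae_have 2 → 3 := WeightedOrientedGraph.not_hasHeavyInNeighbors_of_isCohenMacaulayRing
  tfae_have 3 → 2 := WeightedOrientedGraph.isCohenMacaulayRing_of_not_hasHeavyInNeighbors hD
  tfae_finish
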